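/- Let $F$ be a finite field of characteristic $2$ with $|F|\ge 4$, let $n\ge 2$, and let $A$ be a non-derogatory $n\times n$ matrix over $F$ (that is, the minimal polynomial of $A$ equals its characteristic polynomial), with characteristic polynomial $$p_A(x)=x^n+u_{n-1}x^{n-1}+u_{n-2}x^{n-2}+\cdots .$$ Let $\mathbb{F}_2$ denote the prime subfield of $F$. (i) If $n=2$ and $\operatorname{Trace}(A)=0$, then there exist $n\times n$ matrices $N,D$ over $F$ with $A=N+D$, $N^2=0$ and $D^3=D$. (ii) If $n=4k+2$ for some integer $k\ge 0$ and $\operatorname{Trace}(A)=0$, then for every subfield $K$ of $F$ with $K\ne\mathbb{F}_2$ and $u_{n-2}\in K$ there exist $n\times n$ matrices $N,D$ over $F$ with $A=N+D$, $N^2=0$ and $D^s=D$, where $s=|K|$. (iii) In all other cases, that is, if $n\not\equiv 2 \pmod 4$ or $\operatorname{Trace}(A)\ne 0$, for every subfield $K$ of $F$ with $K\ne\mathbb{F}_2$ and $u_{n-1}\in K$ there exist $n\times n$ matrices $N,D$ over $F$ with $A=N+D$, $N^2=0$ and $D^s=D$, where $s=|K|$. -/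

import Mathlib

/-- A square matrix over a field is non-derogatory if its minimal polynomial coincides with its
characteristic polynomial. -/
def Matrix.IsNonderogatory {F : Type*} [Field F] {n : ℕ} (A : Matrix (Fin n) (Fin n) F) : Prop :=
  minpoly F A = A.charpoly

/-! A cyclic vector `v` and the vectors `∏ j < i, (T - d j) v` form a basis in which `T` is lower
bidiagonal off its last column, with any diagonal `d` of sum the trace. Let `N` be the part of `T`
sending basis vectors of the parity of the last index to those of the other parity; then `N ^ 2 =
0`. If entries of `d` at places of different parity differ and the last entry is simple, `D = T - N`
is diagonalizable with eigenvalues in `K`, so `D ^ |K| = D`. Such a `d` exists in `K` except for `n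
= 2` with trace zero, which is done by hand. -/

open Polynomial

/-! ### Cyclic vectors and bidiagonal form -/

section CyclicBasis

variable {F V : Type*} [Field F] [AddCommGroup V] [Module F V] [FiniteDimensional F V]

/-- An endomorphism of a finite dimensional space has a vector whose annihilating polynomials
annihilate the whole space. -/
theorem Module.End.exists_forall_minpoly_dvd (T : Module.End F V) :
    ∃ v : V, ∀ q : F[X], aeval T q v = 0 → minpoly F T ∣ q := by
  have : Module.Finite F[X] (Module.AEval' T) := inferInstance
  obtain ⟨x, hx⟩ := Module.exists_ker_toSpanSingleton_eq_annihilator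
    (R := F[X]) (M := Module.AEval' T)
  refine ⟨(Module.AEval'.of T).symm x, fun q hq => minpoly.dvd F T ?_⟩
  have h1 : q ∈ LinearMap.ker (LinearMap.toSpanSingleton F[X] (Module.AEval' T) x) := by
    rw [LinearMap.mem_ker, LinearMap.toSpanSingleton_apply]
    apply (Module.AEval'.of T).symm.injective
    rw [map_zero]
    exact hq
  rw [hx] at h1
  ext w
  have h2 := congrArg (Module.AEval'.of T).symm
    (Module.mem_annihilator.mp h1 (Module.AEval'.of T w))
  rw [map_zero] at h2
  exact h2

/-- The sequence of polynomials `∏ j < i, (X - d j)`. -/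
noncomputable def newtonSequence (d : ℕ → F) : Polynomial.Sequence F where
  elems' i := ∏ j ∈ Finset.range i, (X - C (d j))
  degree_eq' i := by simp [degree_prod]

theorem newtonSequence_succ (d : ℕ → F) (i : ℕ) :
    newtonSequence d (i + 1) = (X - C (d i)) * newtonSequence d i := by
  change ∏ j ∈ Finset.range (i + 1), _ = _ * ∏ j ∈ Finset.range i, _
  rw [Finset.prod_range_succ, mul_comm]

/-- A cyclic endomorphism is, in a suitable basis, lower bidiagonal with prescribed diagonal up to
its last column. -/
theorem Module.End.exists_basis_bidiagonal (T : Module.End F V) {m : ℕ}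
    (hV : Module.finrank F V = m + 1) (hT : (minpoly F T).natDegree = m + 1) (d : ℕ → F)
    (hd : ∑ i ∈ Finset.range (m + 1), d i = LinearMap.trace F V T) :
    ∃ b : Module.Basis (Fin (m + 1)) F V,
      (∀ i : Fin m, T (b i.castSucc) = d i • b i.castSucc + b i.succ) ∧
      b.repr (T (b (Fin.last m))) (Fin.last m) = d m := by
  obtain ⟨v, hv⟩ := T.exists_forall_minpoly_dvd
  let q := newtonSequence d
  have hli : LinearIndependent F fun i : Fin (m + 1) => aeval T (q i) v := by
    have hq : LinearIndependent F fun i : Fin (m + 1) => q i :=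
      q.linearIndependent.comp _ Fin.val_injective
    rw [Fintype.linearIndependent_iff] at hq ⊢
    intro g hg
    apply hq
    by_contra hne
    have hdvd : minpoly F T ∣ ∑ i, g i • q i := hv _ (by simpa [map_sum] using hg)
    have h1 := degree_le_of_dvd hdvd hne
    have h2 : (∑ i, g i • q i).degree < (m + 1 : ℕ) := by
      rw [← mem_degreeLT]
      refine Submodule.sum_mem _ fun i _ => Submodule.smul_mem _ _ ?_
      rw [mem_degreeLT, q.degree_eq]
      exact_mod_cast i.2
    rw [degree_eq_natDegree (minpoly.ne_zero_of_finite F T), hT] at h1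
    exact absurd h2 (not_lt.mpr h1)
  let b := basisOfLinearIndependentOfCardEqFinrank hli (by simp [hV])
  have hb : ∀ i, b i = aeval T (q i) v := fun i => by simp [b]
  have hstep : ∀ i : Fin m, T (b i.castSucc) = d i • b i.castSucc + b i.succ := by
    intro i
    rw [hb, hb, Fin.val_succ, newtonSequence_succ, map_mul]
    simp [Module.End.mul_apply, q]
  refine ⟨b, hstep, ?_⟩
  -- Comparing traces forces the one diagonal entry not yet known.
  have htr := LinearMap.trace_eq_matrix_trace F b T
  rw [← hd, Matrix.trace, Fin.sum_univ_castSucc, Finset.sum_range_succ,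
    ← Fin.sum_univ_eq_sum_range] at htr
  have hdiag : ∀ i : Fin m, (LinearMap.toMatrix b b T).diag i.castSucc = d i := by
    intro i
    simp [LinearMap.toMatrix_apply, hstep, Fin.ext_iff]
  simp only [hdiag] at htr
  simpa [LinearMap.toMatrix_apply] using (add_left_cancel htr).symm

end CyclicBasis

/-! ### Splitting off a square-zero part -/

section Diagonalizable

variable {F V : Type*} [Field F] [AddCommGroup V] [Module F V]

theorem aeval_prod_X_sub_C_apply [DecidableEq F] (D : Module.End F V) {R : Finset F} {a : F}
    (ha : a ∈ R) (x : V) :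
    aeval D (∏ c ∈ R, (X - C c)) x = aeval D (∏ c ∈ R.erase a, (X - C c)) (D x - a • x) := by
  rw [← Finset.prod_erase_mul R _ ha, map_mul, Module.End.mul_apply]
  simp

theorem aeval_prod_X_sub_C_apply_eigenvector (D : Module.End F V) {R : Finset F} {a : F}
    (ha : a ∈ R) {x : V} (hx : D x = a • x) : aeval D (∏ c ∈ R, (X - C c)) x = 0 := by
  classical
  rw [aeval_prod_X_sub_C_apply D ha, hx, sub_self, map_zero]

/-- Elements of `K` are distinct roots of `X ^ |K| - X`. -/
theorem Module.End.pow_card_eq_self_of_aeval_prod_eq_zero [Finite F] (D : Module.End F V)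
    (K : Subfield F) (S : Finset F) (hS : ∀ a, a ∈ S ↔ a ∈ K)
    (hD : aeval D (∏ c ∈ S, (X - C c)) = 0) : D ^ Nat.card K = D := by
  have := Fintype.ofFinite K
  have hne : (X ^ Nat.card K - X : F[X]) ≠ 0 :=
    FiniteField.X_pow_card_sub_X_ne_zero F (by simpa using Fintype.one_lt_card)
  have hdvd : ∏ c ∈ S, (X - C c) ∣ (X ^ Nat.card K - X : F[X]) := by
    rw [Finset.prod_eq_multiset_prod, Multiset.prod_X_sub_C_dvd_iff_le_roots hne,
      Multiset.le_iff_subset S.nodup]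
    intro a ha
    have h := congrArg (Subtype.val) (FiniteField.pow_card (⟨a, (hS a).mp ha⟩ : K))
    rw [mem_roots hne]
    simpa [sub_eq_zero, Nat.card_eq_fintype_card] using h
  obtain ⟨r, hr⟩ := hdvd
  have h := congrArg (aeval D) hr
  rw [map_mul, hD, zero_mul] at h
  simpa [sub_eq_zero] using h

/-- The square-zero plus potent decomposition of an endomorphism that is lower bidiagonal up to its
last column. -/
theorem Module.End.exists_sq_eq_zero_sub_pow_card [Finite F] (T : Module.End F V) {m : ℕ}
    (b : Module.Basis (Fin (m + 1)) F V) (d : ℕ → F)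
    (hstep : ∀ i : Fin m, T (b i.castSucc) = d i • b i.castSucc + b i.succ)
    (hlast : b.repr (T (b (Fin.last m))) (Fin.last m) = d m)
    (K : Subfield F) (hK : ∀ i, d i ∈ K)
    (hpar : ∀ i j, i ≤ m → j ≤ m → i % 2 ≠ j % 2 → d i ≠ d j)
    (hsimple : ∀ i < m, i % 2 = m % 2 → d i ≠ d m) :
    ∃ N : Module.End F V, N ^ 2 = 0 ∧ (T - N) ^ Nat.card K = T - N := by
  classical
  have := Fintype.ofFinite F
  let π : Module.End F V := b.constr F fun i => if (i : ℕ) % 2 = m % 2 then 0 else b i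
  have hπ : ∀ i, π (b i) = if (i : ℕ) % 2 = m % 2 then 0 else b i := fun i => b.constr_basis ..
  have hidem : π * π = π := b.ext fun i => by
    rw [Module.End.mul_apply, hπ]
    split_ifs with h
    · rw [map_zero]
    · rw [hπ, if_neg h]
  have hzero : (1 - π) * π = 0 := by rw [sub_mul, one_mul, hidem, sub_self]
  let N : Module.End F V := π * T * (1 - π)
  refine ⟨N, by rw [sq]; simp only [N, mul_assoc]; rw [← mul_assoc (1 - π) π, hzero]; simp, ?_⟩
  set D := T - N with hD
  have hDeven : ∀ i : Fin (m + 1), (i : ℕ) % 2 = m % 2 → D (b i) = T (b i) - π (T (b i)) := by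
    intro i hi
    simp [hD, N, hπ, hi]
  have hDodd : ∀ i : Fin (m + 1), (i : ℕ) % 2 ≠ m % 2 → D (b i) = T (b i) := by
    intro i hi
    simp [hD, N, hπ, hi]
  have heigen : ∀ i : Fin m, (i : ℕ) % 2 = m % 2 → D (b i.castSucc) = d i • b i.castSucc := by
    intro i hi
    have : ((i : ℕ) + 1) % 2 ≠ m % 2 := by omega
    rw [hDeven _ (by simpa using hi), hstep]
    simp [hπ, hi, this]
  have htop : D (b (Fin.last m)) - d m • b (Fin.last m) =
      ∑ i : Fin m, b.repr (T (b (Fin.last m))) i.castSucc • (b i.castSucc - π (b i.castSucc)) := by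
    rw [hDeven _ (by simp)]
    conv_lhs => rw [← b.sum_repr (T (b (Fin.last m))), Fin.sum_univ_castSucc, hlast]
    simp [hπ, smul_sub, Finset.sum_sub_distrib]
    abel
  have heven : ∀ R : Finset F, (∀ i ≤ m, i % 2 = m % 2 → d i ∈ R) →
      ∀ i : Fin (m + 1), (i : ℕ) % 2 = m % 2 → aeval D (∏ c ∈ R, (X - C c)) (b i) = 0 := by
    intro R hR i hi
    induction i using Fin.lastCases with
    | cast i =>
      exact aeval_prod_X_sub_C_apply_eigenvector D (hR i i.2.le (by simpa using hi))
        (heigen i (by simpa using hi))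
    | last =>
      -- The factor `X - d m` sends the last vector to a combination of eigenvectors; since `d m` is
      -- simple, the remaining factors kill them.
      rw [aeval_prod_X_sub_C_apply D (hR m le_rfl rfl), htop, map_sum]
      refine Finset.sum_eq_zero fun j _ => ?_
      rw [map_smul, hπ]
      split_ifs with hj
      · have hj' : (j : ℕ) % 2 = m % 2 := by simpa using hj
        rw [sub_zero, aeval_prod_X_sub_C_apply_eigenvector D _ (heigen j hj'), smul_zero]
        exact Finset.mem_erase.mpr ⟨hsimple j j.2 hj', hR j j.2.le hj'⟩
      · simp
  let S : Finset F := Finset.univ.filter (· ∈ K)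
  have hS : ∀ a, a ∈ S ↔ a ∈ K := by simp [S]
  refine D.pow_card_eq_self_of_aeval_prod_eq_zero K S hS (b.ext fun i => ?_)
  rw [LinearMap.zero_apply]
  by_cases hi : (i : ℕ) % 2 = m % 2
  · exact heven S (fun i _ _ => (hS _).mpr (hK i)) i hi
  · induction i using Fin.lastCases with
    | last => simp at hi
    | cast i =>
      have hi' : (i : ℕ) % 2 ≠ m % 2 := by simpa using hi
      -- `X - d i` moves `b i` to `b (i + 1)`, which is killed without that factor, as `d i` does
      -- not occur in the other parity.
      rw [aeval_prod_X_sub_C_apply D ((hS _).mpr (hK i)), hDodd _ hi, hstep, add_sub_cancel_left]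
      refine heven _ (fun j hj hjm => ?_) _ (by rw [Fin.val_succ]; omega)
      exact Finset.mem_erase.mpr ⟨hpar j i hj i.2.le (by omega), (hS _).mpr (hK j)⟩

end Diagonalizable

/-! ### Choice of the diagonal -/

section Diagonal

variable {F : Type*} [Field F]

theorem Subfield.exists_ne_zero_ne_one_of_ne_bot {K : Subfield F} (hK : K ≠ ⊥) :
    ∃ w ∈ K, w ≠ 0 ∧ w ≠ 1 := by
  by_contra! h
  refine hK (le_bot_iff.mp fun x hx => ?_)
  by_cases hx0 : x = 0
  · exact hx0 ▸ zero_mem _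
  · exact h x hx hx0 ▸ one_mem _

theorem Subfield.exists_mem_ne_ne_of_ne_bot {K : Subfield F} (hK : K ≠ ⊥) (x y : F) :
    ∃ z ∈ K, z ≠ x ∧ z ≠ y := by
  obtain ⟨w, hw, hw0, hw1⟩ := Subfield.exists_ne_zero_ne_one_of_ne_bot hK
  by_contra! h
  have h0 := h 0 (zero_mem _)
  have h1 := h 1 (one_mem _)
  have h2 := h w hw
  have h3 : (0 : F) ≠ 1 := zero_ne_one
  by_cases hx0 : 0 = x
  · subst hx0
    exact hw1 ((h2 hw0).trans (h1 h3.symm).symm)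
  · by_cases hx1 : 1 = x
    · subst hx1
      exact hw0 ((h2 hw1).trans (h0 hx0).symm)
    · exact h3 ((h0 hx0).trans (h1 hx1).symm)

theorem sum_range_four_mul_alternating [CharP F 2] (x a : F) (k : ℕ) (f : ℕ → F)
    (hf : ∀ i < 4 * k, f i = if i % 2 = 0 then x else a) : ∑ i ∈ Finset.range (4 * k), f i = 0 := by
  induction k with
  | zero => simp
  | succ k ih =>
    rw [show 4 * (k + 1) = 4 * k + 1 + 1 + 1 + 1 by ring]
    simp only [Finset.sum_range_succ]
    rw [ih fun i hi => hf i (by omega), hf _ (by omega), hf _ (by omega), hf _ (by omega),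
      hf _ (by omega)]
    have h2 : (2 : F) = 0 := CharTwo.two_eq_zero
    simp only [show 4 * k % 2 = 0 by omega, show (4 * k + 1) % 2 = 1 by omega,
      show (4 * k + 1 + 1) % 2 = 0 by omega, show (4 * k + 1 + 1 + 1) % 2 = 1 by omega]
    simp only [if_true, one_ne_zero, if_false]
    linear_combination (x + a) * h2

/-- A diagonal with entries in `K` and prescribed sum, whose entries in places of different parity
differ and whose last entry is simple. -/
theorem Subfield.exists_diagonal_of_ne_bot [CharP F 2] {K : Subfield F} (hK : K ≠ ⊥) {t : F}
    (ht : t ∈ K) {m : ℕ} (hm : 1 ≤ m) (hmt : ¬ (m = 1 ∧ t = 0)) :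
    ∃ d : ℕ → F, (∀ i, d i ∈ K) ∧ ∑ i ∈ Finset.range (m + 1), d i = t ∧
      (∀ i j, i ≤ m → j ≤ m → i % 2 ≠ j % 2 → d i ≠ d j) ∧
      ∀ i < m, i % 2 = m % 2 → d i ≠ d m := by
  have h2 : (2 : F) = 0 := CharTwo.two_eq_zero
  obtain ⟨w, hw, hw0, hw1⟩ := Subfield.exists_ne_zero_ne_one_of_ne_bot hK
  have hw2 : w + 1 ≠ 0 := fun h => hw1 (by linear_combination h - h2)
  obtain ⟨k, hk⟩ : ∃ k, m = 4 * k ∨ m = 4 * k + 1 ∨ m = 4 * k + 2 ∨ m = 4 * k + 3 :=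
    ⟨m / 4, by omega⟩
  rcases hk with rfl | rfl | rfl | rfl
  · obtain ⟨x, hx, hxt, -⟩ := Subfield.exists_mem_ne_ne_of_ne_bot hK t t
    obtain ⟨a, ha, hax, hat⟩ := Subfield.exists_mem_ne_ne_of_ne_bot hK x t
    refine ⟨fun i => if i = 4 * k then t else if i % 2 = 0 then x else a, ?_, ?_, ?_, ?_⟩
    · intro i; dsimp only; split_ifs <;> assumption
    · rw [Finset.sum_range_succ, sum_range_four_mul_alternating x a k]
      · simp
      · intro i hi
        simp [hi.ne]
    · grind
    · grind
  · by_cases ht0 : t = 0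
    · have hk0 : k ≠ 0 := by
        rintro rfl
        exact hmt ⟨rfl, ht0⟩
      obtain ⟨k, rfl⟩ := Nat.exists_eq_succ_of_ne_zero hk0
      rw [Nat.succ_eq_add_one]
      -- The last three odd places carry `w`, `1`, `w + 1`, whose sum is zero.
      refine ⟨fun i => if i = 4 * (k + 1) + 1 then w + 1 else if i % 2 = 0 then 0 else
        if i = 4 * k + 1 then w else 1, ?_, ?_, ?_, ?_⟩
      · intro i; dsimp only
        split_ifs <;> first | assumption | exact zero_mem _ | exact one_mem _ | skip
        exact add_mem hw (one_mem _)
      · rw [show 4 * (k + 1) + 1 + 1 = 4 * k + 1 + 1 + 1 + 1 + 1 + 1 by ring]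
        simp only [Finset.sum_range_succ]
        rw [sum_range_four_mul_alternating 0 1 k]
        · grind
        · grind
      · grind
      · grind
    · obtain ⟨x, hx, hx0, hxt⟩ := Subfield.exists_mem_ne_ne_of_ne_bot hK 0 t
      refine ⟨fun i => if i = 4 * k + 1 then t else if i % 2 = 0 then 0 else x, ?_, ?_, ?_, ?_⟩
      · intro i; dsimp only
        split_ifs <;> first | assumption | exact zero_mem _
      · simp only [Finset.sum_range_succ]
        rw [sum_range_four_mul_alternating 0 x k]
        · grind
        · grind
      · grind
      · grind
  · obtain ⟨x, hx, hxt, -⟩ := Subfield.exists_mem_ne_ne_of_ne_bot hK t t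
    obtain ⟨y, hy, hyx, hyt⟩ := Subfield.exists_mem_ne_ne_of_ne_bot hK x t
    have hax : x + y + t ≠ x := fun h => hyt (by linear_combination h - t * h2)
    have hay : x + y + t ≠ y := fun h => hxt (by linear_combination h - t * h2)
    -- The value `x + y + t` is forced by the sum.
    refine ⟨fun i => if i = 4 * k + 2 then y else if i % 2 = 0 then x else x + y + t,
      ?_, ?_, ?_, ?_⟩
    · intro i; dsimp only
      split_ifs <;> first | assumption | exact add_mem (add_mem hx hy) ht
    · simp only [Finset.sum_range_succ]
      rw [sum_range_four_mul_alternating x (x + y + t) k]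
      · grind
      · grind
    · grind
    · grind
  · by_cases ht0 : t = 0
    · refine ⟨fun i => if i = 4 * k + 3 then w + 1 else if i % 2 = 1 then w else
        if i = 4 * k + 2 then 1 else 0, ?_, ?_, ?_, ?_⟩
      · intro i; dsimp only
        split_ifs <;> first | assumption | exact zero_mem _ | exact one_mem _ | skip
        exact add_mem hw (one_mem _)
      · simp only [Finset.sum_range_succ]
        rw [sum_range_four_mul_alternating 0 w k]
        · grind
        · grind
      · grind
      · grind
    · obtain ⟨a, ha, ha0, hat⟩ := Subfield.exists_mem_ne_ne_of_ne_bot hK 0 t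
      refine ⟨fun i => if i = 4 * k + 3 then t else if i % 2 = 0 then a else 0, ?_, ?_, ?_, ?_⟩
      · intro i; dsimp only
        split_ifs <;> first | assumption | exact zero_mem _
      · simp only [Finset.sum_range_succ]
        rw [sum_range_four_mul_alternating a 0 k]
        · grind
        · grind
      · grind
      · grind

end Diagonal

/-! ### Matrices, and the case `n = 2` -/

section Matrix

variable {F : Type*} [Field F]

theorem Matrix.exists_sq_eq_zero_add_pow_eq_self_of_toLin' {n : ℕ} (A : Matrix (Fin n) (Fin n) F)
    (s : ℕ) (h : ∃ N : Module.End F (Fin n → F), N ^ 2 = 0 ∧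
      (Matrix.toLin' A - N) ^ s = Matrix.toLin' A - N) :
    ∃ N D : Matrix (Fin n) (Fin n) F, A = N + D ∧ N ^ 2 = 0 ∧ D ^ s = D := by
  obtain ⟨N, hN, hD⟩ := h
  let φ := LinearMap.toMatrixAlgEquiv' (R := F) (n := Fin n)
  have hA : φ (Matrix.toLin' A) = A := LinearMap.toMatrix'_toLin' A
  refine ⟨φ N, A - φ N, by abel, ?_, ?_⟩
  · rw [← map_pow, hN, map_zero]
  · have := congrArg φ hD
    rwa [map_pow, map_sub, hA] at this

theorem Matrix.IsNonderogatory.natDegree_minpoly_toLin' {n : ℕ} {A : Matrix (Fin n) (Fin n) F}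
    (hA : A.IsNonderogatory) : (minpoly F (Matrix.toLin' A)).natDegree = n := by
  rw [Matrix.minpoly_toLin', hA, Matrix.charpoly_natDegree_eq_dim, Fintype.card_fin]

theorem Matrix.IsNonderogatory.exists_sq_eq_zero_add_pow_card [Finite F] [CharP F 2] {n : ℕ}
    (hn : 2 ≤ n) {A : Matrix (Fin n) (Fin n) F} (hA : A.IsNonderogatory) (K : Subfield F)
    (hK : K ≠ ⊥) (ht : A.trace ∈ K) (hnt : ¬ (n = 2 ∧ A.trace = 0)) :
    ∃ N D : Matrix (Fin n) (Fin n) F, A = N + D ∧ N ^ 2 = 0 ∧ D ^ Nat.card K = D := by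
  obtain ⟨m, rfl⟩ : ∃ m, n = m + 1 := ⟨n - 1, by omega⟩
  obtain ⟨d, hdK, hsum, hpar, hsimple⟩ :=
    Subfield.exists_diagonal_of_ne_bot hK ht (m := m) (by omega) (by simpa using hnt)
  obtain ⟨b, hstep, hlast⟩ := Module.End.exists_basis_bidiagonal (Matrix.toLin' A) (m := m) (by simp)
    hA.natDegree_minpoly_toLin' d (by rw [hsum, Matrix.trace_toLin'_eq])
  exact A.exists_sq_eq_zero_add_pow_eq_self_of_toLin' _
    (Module.End.exists_sq_eq_zero_sub_pow_card _ b d hstep hlast K hdK hpar hsimple)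

theorem Matrix.IsNonderogatory.exists_sq_eq_zero_add_tripotent_two [CharP F 2]
    {A : Matrix (Fin 2) (Fin 2) F} (hA : A.IsNonderogatory) (ht : A.trace = 0) :
    ∃ N D : Matrix (Fin 2) (Fin 2) F, A = N + D ∧ N ^ 2 = 0 ∧ D ^ 3 = D := by
  obtain ⟨b, hstep, hlast⟩ := Module.End.exists_basis_bidiagonal (Matrix.toLin' A) (m := 1) (by simp)
    hA.natDegree_minpoly_toLin' (fun _ => 0) (by simp [ht])
  set T := Matrix.toLin' A
  have h0 : T (b 0) = b 1 := by simpa using hstep 0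
  have h1 : T (b 1) = b.repr (T (b 1)) 0 • b 0 := by
    conv_lhs => rw [← b.sum_repr (T (b 1)), Fin.sum_univ_two]
    have : b.repr (T (b 1)) 1 = 0 := hlast
    simp [this]
  refine A.exists_sq_eq_zero_add_pow_eq_self_of_toLin' 3 ?_
  -- `N` is chosen so that `T - N` swaps the basis; `T (b 1)` is a multiple of `b 0`, so `N ^ 2 =
  -- 0`.
  let N : Module.End F (Fin 2 → F) := b.constr F ![0, T (b 1) - b 0]
  have hN0 : N (b 0) = 0 := by simp [N, b.constr_basis]
  have hN1 : N (b 1) = T (b 1) - b 0 := by simp [N, b.constr_basis]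
  have hD0 : (T - N) (b 0) = b 1 := by simp [hN0, h0]
  have hD1 : (T - N) (b 1) = b 0 := by simp [hN1]
  refine ⟨N, b.ext fun i => ?_, b.ext fun i => ?_⟩
  · rw [sq, Module.End.mul_apply]
    fin_cases i
    · simp [hN0]
    · simp only [Fin.mk_one, hN1]
      rw [h1]
      simp [hN0]
  · change ((T - N) ^ 3) (b i) = (T - N) (b i)
    rw [pow_succ, sq, Module.End.mul_apply, Module.End.mul_apply]
    fin_cases i
    · simp only [Fin.zero_eta, hD0, hD1]
    · simp only [Fin.mk_one, hD0, hD1]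

/-- `D` is the scalar `e` with `e ^ 2 = det A`; by Cayley–Hamilton `(A - e) ^ 2 = 0`. -/
theorem Matrix.exists_sq_eq_zero_add_pow_card_two [Finite F] [CharP F 2]
    (A : Matrix (Fin 2) (Fin 2) F) (ht : A.trace = 0) (K : Subfield F) (hK : A.det ∈ K) :
    ∃ N D : Matrix (Fin 2) (Fin 2) F, A = N + D ∧ N ^ 2 = 0 ∧ D ^ Nat.card K = D := by
  have := Fintype.ofFinite K
  obtain ⟨⟨e, he⟩, hee⟩ := FiniteField.isSquare_of_char_two (F := K)
    (CharP.ringChar_of_prime_eq_zero Nat.prime_two (by ext; exact CharTwo.two_eq_zero)) ⟨A.det, hK⟩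
  have hdet : A.det = e * e := congrArg Subtype.val hee
  refine ⟨A - Matrix.scalar _ e, Matrix.scalar _ e, by abel, ?_, ?_⟩
  · have h2 : (2 : F) = 0 := CharTwo.two_eq_zero
    rw [Matrix.det_fin_two] at hdet
    rw [Matrix.trace_fin_two] at ht
    ext i j
    rw [sq, Matrix.mul_apply, Fin.sum_univ_two]
    fin_cases i <;> fin_cases j <;> simp
    · linear_combination (A 0 0) * ht - hdet - e * A 0 0 * h2
    · linear_combination (A 0 1) * ht - A 0 1 * e * h2
    · linear_combination (A 1 0) * ht - A 1 0 * e * h2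
    · linear_combination (A 1 1) * ht - hdet - e * A 1 1 * h2
  · rw [← map_pow]
    congr 1
    simpa using congrArg Subtype.val (FiniteField.pow_card (⟨e, he⟩ : K))

end Matrix

theorem proposition3p4 {F : Type*} [Field F] [Finite F] [CharP F 2] (hF : 4 ≤ Nat.card F)
    (n : ℕ) (hn : 2 ≤ n) (A : Matrix (Fin n) (Fin n) F) (hA : A.IsNonderogatory) :
    ((n = 2 ∧ A.trace = 0) →
      ∃ N D : Matrix (Fin n) (Fin n) F, A = N + D ∧ N ^ 2 = 0 ∧ D ^ 3 = D) ∧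
    (((∃ k : ℕ, n = 4 * k + 2) ∧ A.trace = 0) →
      ∀ K : Subfield F, K ≠ ⊥ → A.charpoly.coeff (n - 2) ∈ K →
        ∃ N D : Matrix (Fin n) (Fin n) F, A = N + D ∧ N ^ 2 = 0 ∧ D ^ Nat.card K = D) ∧
    (¬ ((∃ k : ℕ, n = 4 * k + 2) ∧ A.trace = 0) →
      ∀ K : Subfield F, K ≠ ⊥ → A.charpoly.coeff (n - 1) ∈ K →
        ∃ N D : Matrix (Fin n) (Fin n) F, A = N + D ∧ N ^ 2 = 0 ∧ D ^ Nat.card K = D) := by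
  refine ⟨?_, ?_, ?_⟩
  · rintro ⟨rfl, ht⟩
    exact hA.exists_sq_eq_zero_add_tripotent_two ht
  · rintro ⟨-, ht⟩ K hK hu
    by_cases h2 : n = 2
    · subst h2
      refine A.exists_sq_eq_zero_add_pow_card_two ht K ?_
      rw [Matrix.det_eq_sign_charpoly_coeff]
      simpa using hu
    -- For `n > 2` the zero trace already lies in `K`.
    · exact hA.exists_sq_eq_zero_add_pow_card hn K hK (ht ▸ zero_mem K) fun h => h2 h.1
  · intro hnt K hK hu
    have : Nonempty (Fin n) := ⟨⟨0, by omega⟩⟩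
    refine hA.exists_sq_eq_zero_add_pow_card hn K hK ?_ fun h => hnt ⟨⟨0, h.1⟩, h.2⟩
    rw [Matrix.trace_eq_neg_charpoly_coeff, Fintype.card_fin]
    exact neg_mem hu
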